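/- For sets $A,B\subseteq\mathbb N$, write $B\le_{tt}A$ ($B$ is truth-table reducible to $A$) if there are total computable functions $f$ and $g$ such that, for every $m$, $f(m)$ is a natural number, $g(m)$ is a (code of a) truth table assigning to each binary string $\sigma$ of length $f(m)$ a value in $\{0,1\}$, and $m\in B$ if and only if the value assigned to the string $A(0)A(1)\cdots A(f(m)-1)$ is $1$. A computably enumerable (c.e.) set $A$ is Turing complete if every c.e. set is Turing reducible to $A$. Theorem. There exist Turing complete c.e. sets $A_1,A_2\subseteq\mathbb N$ whose tt-degrees form a minimal pair in the structure of all tt-degrees; that is, neither $A_1$ nor $A_2$ is computable, and every set $B\subseteq\mathbb N$ (c.e. or not) with $B\le_{tt}A_1$ and $B\le_{tt}A_2$ is computable. -/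

import Mathlib

namespace TTMinimalPair

open scoped Computability

/-- A set of natural numbers is computably enumerable. -/
def IsCE (A : Set ℕ) : Prop := REPred fun n => n ∈ A

/-- A set of natural numbers is computable. -/
def IsComputable (A : Set ℕ) : Prop := ComputablePred fun n => n ∈ A

open Classical in
/-- The characteristic function of `A`, as an everywhere defined partial function
(the form in which Mathlib takes oracles). -/
noncomputable def charFun (A : Set ℕ) : ℕ →. ℕ :=
  fun n => Part.some (if n ∈ A then 1 else 0)

/-- Turing reducibility of sets. -/
def TuringLE (B A : Set ℕ) : Prop := charFun B ≤ᵀ charFun A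

/-- `A` is a Turing complete c.e. set: it is c.e. and every c.e. set is Turing reducible to it. -/
def IsTuringCompleteCE (A : Set ℕ) : Prop :=
  IsCE A ∧ ∀ C : Set ℕ, IsCE C → TuringLE C A

open Classical in
/-- The binary string `A ↾ n` of length `n`, that is, `A(0) A(1) … A(n-1)`. -/
noncomputable def initSeg (A : Set ℕ) (n : ℕ) : List Bool :=
  (List.range n).map fun k => decide (k ∈ A)

/-- Truth-table reducibility `B ≤_tt A`. The reduction is given by two (total) computable functions:
`f m` bounds the use on input `m`, and `g m` codes the truth table on the rows `σ ∈ 2^(f m)`, by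
listing the rows on which the output is `1`; the output is `0` on all other rows of length `f m`. -/
def TTLE (B A : Set ℕ) : Prop :=
  ∃ (f : ℕ → ℕ) (g : ℕ → List (List Bool)), Computable f ∧ Computable g ∧
    ∀ m, m ∈ B ↔ initSeg A (f m) ∈ g m

/-- The tt-degrees of `A₁` and `A₂` form a minimal pair: both are nonzero (where the zero degree is
the degree of the computable sets), and zero is the only tt-degree below both of them. -/
def IsTTMinimalPair (A₁ A₂ : Set ℕ) : Prop :=
  ¬ IsComputable A₁ ∧ ¬ IsComputable A₂ ∧
    ∀ B : Set ℕ, TTLE B A₁ → TTLE B A₂ → IsComputable B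

end TTMinimalPair

namespace TTMinimalPair

open Nat.Partrec (Code)
open Nat.Partrec.Code Encodable Denumerable

/-! ### Primitive recursiveness of bounded quantifiers. -/

section Quantifiers

variable {α β : Type*} [Primcodable α] [Primcodable β]

/-! A finite injury argument with one sequence of movable markers, whose final positions make up the
two complements, alternating by parity of index. Cutting at `c` enumerates the current positions of
all markers from `c` on and moves them far out. Cuts are made to code halting computations and to
secure disagreements between pairs of reductions; each marker settles (`eventually_le_nextCut`).

Minimality: suppose the `e`-th pair agrees on the limit sets. For `c ≥ e`, it also agrees on the
sets obtained by enumerating all markers from the settled `c`-th on, since otherwise a late cut at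
`c` would be demanded (`cutSeg_mem_iff`). Passing from `c` to `c + 1` changes only one of the two
sets, so the common answer is the one given by the unchanged side. By induction the true answer is
the one at `c = e`, where the set is cofinite and the answer computable
(`initSeg_mem_iff_cutSeg_mem`).

Completeness: markers `2k` and `2k + 1` both move when computation `k` halts, so a position that
stays in a complement certifies that `k` has been decided (`haltsBy_of_marker_notMem`). The limit
set finds such a position by search. -/

lemma primrecPred_exists_lt {R : α → ℕ → Prop} {n : α → ℕ} (hn : Primrec n)
    (hR : PrimrecRel R) : PrimrecPred fun a => ∃ x < n a, R a x := by
  have h : PrimrecRel fun (x : ℕ) (a : α) => R a x := hR.comp Primrec.snd Primrec.fst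
  exact (h.exists_mem_list.comp (Primrec.list_range.comp hn) Primrec.id).of_eq (by simp)

lemma primrecPred_forall_lt {R : α → ℕ → Prop} {n : α → ℕ} (hn : Primrec n)
    (hR : PrimrecRel R) : PrimrecPred fun a => ∀ x < n a, R a x := by
  have h : PrimrecRel fun (x : ℕ) (a : α) => R a x := hR.comp Primrec.snd Primrec.fst
  exact (h.forall_mem_list.comp (Primrec.list_range.comp hn) Primrec.id).of_eq (by simp)

lemma primrecPred_exists_mem_list {R : α → β → Prop} {l : α → List β} (hl : Primrec l)
    (hR : PrimrecRel R) : PrimrecPred fun a => ∃ x ∈ l a, R a x := by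
  have h : PrimrecRel fun (x : β) (a : α) => R a x := hR.comp Primrec.snd Primrec.fst
  exact (h.exists_mem_list.comp hl Primrec.id).of_eq (by simp)

lemma primrecPred_exists_mem_option {R : α → β → Prop} {o : α → Option β} (ho : Primrec o)
    (hR : PrimrecRel R) : PrimrecPred fun a => ∃ x ∈ o a, R a x := by
  have h : Primrec fun a => (o a).toList :=
    (Primrec.option_casesOn ho (Primrec.const [])
      (Primrec.list_cons.comp Primrec.snd (Primrec.const [])).to₂).of_eq
      fun a => by cases o a <;> rfl
  exact (primrecPred_exists_mem_list h hR).of_eq (by simp)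

end Quantifiers

/-! ### The construction. -/

/-- Reading a history of cuts (most recent first), the time of the last cut at or below `j`. -/
def stamp : List ℕ → ℕ → ℕ
  | [], _ => 0
  | c :: H, j => if c ≤ j then H.length + 1 else stamp H j

/-- The position of the `j`-th marker after the history `H` of cuts. The markers of even index are
the elements of the complement of the first set, those of odd index belong to the second one. -/
def marker (H : List ℕ) (j : ℕ) : ℕ := j + 2 * (stamp H j * stamp H j)

/-- Membership in the `i`-th set if, after the history `H`, all markers from the `c`-th on are
enumerated. -/
def InCut (i : ℕ) (H : List ℕ) (c x : ℕ) : Prop := ∀ j < c, ¬ (j % 2 = i ∧ marker H j = x)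

instance (i : ℕ) (H : List ℕ) (c x : ℕ) : Decidable (InCut i H c x) :=
  inferInstanceAs (Decidable (∀ j < c, ¬ (j % 2 = i ∧ marker H j = x)))

/-- The initial segment of length `n` of the set described by `InCut`. -/
def cutSeg (i : ℕ) (H : List ℕ) (c n : ℕ) : List Bool :=
  (List.range n).map fun x => decide (InCut i H c x)

/-- A use together with a truth table, given by the list of its accepted rows. -/
abbrev Table := ℕ × List (List Bool)

/-- The pair of truth tables that the `e`-th program outputs on `m` within `s` steps. -/
def tables (e s m : ℕ) : Option (Table × Table) := (evaln s (ofNat Code e) m).bind decode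

/-- Within `H.length` steps, the `e`-th pair of truth table reductions is seen to disagree on some
argument with both uses at most `b`, if all markers from the `c`-th on are enumerated. -/
def Disagree (H : List ℕ) (c b e : ℕ) : Prop :=
  ∃ m < H.length, ∃ T ∈ tables e H.length m, T.1.1 ≤ b ∧ T.2.1 ≤ b ∧
    ¬ (cutSeg 0 H c T.1.1 ∈ T.1.2 ↔ cutSeg 1 H c T.2.1 ∈ T.2.2)

/-- The `k`-th computation halts within `s` steps. -/
def HaltsBy (s k : ℕ) : Prop := (evaln s (ofNat Code k.unpair.1) k.unpair.2).isSome = true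

/-- The `c`-th marker wants to be moved: it has to code a new halting computation, or enumerating
it makes a new pair of truth table reductions disagree. -/
def Attention (H : List ℕ) (c : ℕ) : Prop :=
  (c % 2 = 0 ∧ ¬ HaltsBy H.length (c / 2) ∧ HaltsBy (H.length + 1) (c / 2)) ∨
    ∃ e < c + 1, Disagree H c H.length e ∧ ¬ Disagree H c (marker H c) e

open Classical in
/-- The first marker to be enumerated after the history `H`. -/
noncomputable def nextCut (H : List ℕ) : ℕ :=
  (List.range H.length).findIdx fun c => decide (Attention H c)

/-- The history of the first `s` cuts of the construction. -/
noncomputable def hist : ℕ → List ℕ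
  | 0 => []
  | s + 1 => nextCut (hist s) :: hist s

/-- The c.e. sets that are constructed, for `i = 0` and `i = 1`. -/
def limitSet (i : ℕ) : Set ℕ := {x | ∃ s, InCut i (hist s) (x + 1) x}

/-! ### The construction is primitive recursive. -/

section Computability

open Primrec

lemma primrec_stamp : Primrec₂ stamp := by
  have h : Primrec fun p : List ℕ × ℕ => (List.rec (motive := fun _ => ℕ) 0
      (fun c H r => if c ≤ p.2 then H.length + 1 else r) p.1 : ℕ) :=
    Primrec.list_rec Primrec.fst (Primrec.const 0)
      (h := fun p (q : ℕ × List ℕ × ℕ) => if q.1 ≤ p.2 then q.2.1.length + 1 else q.2.2)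
      (Primrec.ite (Primrec.nat_le.comp (fst.comp snd) (snd.comp fst))
        (Primrec.succ.comp (list_length.comp (fst.comp (snd.comp snd))))
        (snd.comp (snd.comp snd)))
  refine h.of_eq fun p => ?_
  obtain ⟨H, j⟩ := p
  induction H with
  | nil => rfl
  | cons c H ih => simp only [stamp] at ih ⊢; rw [ih]

lemma primrec_marker : Primrec₂ marker :=
  nat_add.comp snd (nat_mul.comp (const 2) (nat_mul.comp primrec_stamp primrec_stamp))

lemma primrecPred_inCut (i : ℕ) :
    PrimrecPred fun p : (List ℕ × ℕ) × ℕ => InCut i p.1.1 p.1.2 p.2 := by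
  refine primrecPred_forall_lt (snd.comp fst) (PrimrecPred.not (PrimrecPred.and ?_ ?_))
  · exact Primrec.eq.comp (nat_mod.comp snd (const 2)) (const i)
  · exact Primrec.eq.comp (primrec_marker.comp (fst.comp (fst.comp fst)) snd) (snd.comp fst)

lemma primrec_cutSeg (i : ℕ) :
    Primrec fun p : (List ℕ × ℕ) × ℕ => cutSeg i p.1.1 p.1.2 p.2 :=
  list_map (list_range.comp snd)
    ((primrecPred_inCut i).decide.comp (Primrec.pair (fst.comp fst) snd)).to₂

lemma primrec_tables : Primrec fun p : (ℕ × ℕ) × ℕ => tables p.1.1 p.1.2 p.2 :=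
  option_bind (primrec_evaln.comp (Primrec.pair (Primrec.pair (snd.comp fst)
    ((Primrec.ofNat Code).comp (fst.comp fst))) snd)) (Primrec.decode.comp snd)

lemma primrecPred_iff {α : Type*} [Primcodable α] {p q : α → Prop} (hp : PrimrecPred p)
    (hq : PrimrecPred q) : PrimrecPred fun a => p a ↔ q a :=
  ((hp.and hq).or (hp.not.and hq.not)).of_eq fun a => by tauto

lemma primrecPred_mem_list {α : Type*} [Primcodable α] {σ : α → List Bool}
    {g : α → List (List Bool)} (hσ : Primrec σ) (hg : Primrec g) :
    PrimrecPred fun a => σ a ∈ g a :=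
  (primrecPred_exists_mem_list (R := fun a τ => τ = σ a) hg
    (Primrec.eq.comp snd (hσ.comp fst))).of_eq fun a => by simp

lemma primrecPred_disagree :
    PrimrecPred fun p : ((List ℕ × ℕ) × ℕ) × ℕ => Disagree p.1.1.1 p.1.1.2 p.1.2 p.2 := by
  have hH : Primrec fun p : ((List ℕ × ℕ) × ℕ) × ℕ => p.1.1.1 := fst.comp (fst.comp fst)
  refine primrecPred_exists_lt (list_length.comp hH) ?_
  refine primrecPred_exists_mem_option (primrec_tables.comp (Primrec.pair (Primrec.pair
    (snd.comp fst) (list_length.comp (hH.comp fst))) snd)) ?_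
  have hb : Primrec fun q : ((((List ℕ × ℕ) × ℕ) × ℕ) × ℕ) × (Table × Table) => q.1.1.1.2 :=
    snd.comp (fst.comp (fst.comp fst))
  have hc : Primrec fun q : ((((List ℕ × ℕ) × ℕ) × ℕ) × ℕ) × (Table × Table) => q.1.1.1.1 :=
    fst.comp (fst.comp (fst.comp fst))
  have h₁ : Primrec fun q : ((((List ℕ × ℕ) × ℕ) × ℕ) × ℕ) × (Table × Table) => q.2.1 :=
    fst.comp snd
  have h₂ : Primrec fun q : ((((List ℕ × ℕ) × ℕ) × ℕ) × ℕ) × (Table × Table) => q.2.2 :=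
    snd.comp snd
  have hu₁ := PrimrecRel.comp nat_le (fst.comp h₁) hb
  have hu₂ := PrimrecRel.comp nat_le (fst.comp h₂) hb
  have hr₁ := primrecPred_mem_list ((primrec_cutSeg 0).comp (Primrec.pair hc (fst.comp h₁)))
    (snd.comp h₁)
  have hr₂ := primrecPred_mem_list ((primrec_cutSeg 1).comp (Primrec.pair hc (fst.comp h₂)))
    (snd.comp h₂)
  exact hu₁.and (hu₂.and (primrecPred_iff hr₁ hr₂).not)

lemma primrecRel_haltsBy : PrimrecRel HaltsBy :=
  Primrec.eq.comp (option_isSome.comp (primrec_evaln.comp (Primrec.pair (Primrec.pair fst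
    ((Primrec.ofNat Code).comp (fst.comp (Primrec.unpair.comp snd))))
    (snd.comp (Primrec.unpair.comp snd))))) (const true)

lemma primrecRel_attention : PrimrecRel Attention := by
  have hk : Primrec fun p : List ℕ × ℕ => p.2 / 2 := nat_div.comp snd (const 2)
  have hs : Primrec fun p : List ℕ × ℕ => p.1.length := list_length.comp fst
  refine PrimrecPred.or (PrimrecPred.and ?_ (PrimrecPred.and (PrimrecPred.not ?_) ?_)) ?_
  · exact Primrec.eq.comp (nat_mod.comp snd (const 2)) (const 0)
  · exact primrecRel_haltsBy.comp hs hk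
  · exact primrecRel_haltsBy.comp (Primrec.succ.comp hs) hk
  · refine primrecPred_exists_lt (Primrec.succ.comp snd)
      (PrimrecPred.and ?_ (PrimrecPred.not ?_))
    · exact primrecPred_disagree.comp (Primrec.pair (Primrec.pair fst (hs.comp fst)) snd)
    · exact primrecPred_disagree.comp
        (Primrec.pair (Primrec.pair fst (primrec_marker.comp (fst.comp fst) (snd.comp fst))) snd)

lemma primrec_nextCut : Primrec nextCut := by
  classical
  exact list_findIdx (list_range.comp list_length) primrecRel_attention.decide

lemma primrec_hist : Primrec hist := by
  have h : Primrec (Nat.rec (motive := fun _ => List ℕ) [] fun _ H => nextCut H :: H) :=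
    nat_rec₁ [] (list_cons.comp (primrec_nextCut.comp snd) snd)
  refine h.of_eq fun s => ?_
  induction s with
  | zero => rfl
  | succ s ih => simp only [hist] at ih ⊢; rw [ih]

end Computability

/-! ### Movement of the markers and the limit sets. -/

section Markers

@[simp] lemma length_hist (s : ℕ) : (hist s).length = s := by
  induction s with
  | zero => rfl
  | succ s ih => simp [hist, ih]

/-- Equality is the default of `findIdx`, when no marker requires attention. Hence markers of index
at least the length move at every stage. -/
lemma nextCut_le_length (H : List ℕ) : nextCut H ≤ H.length := by
  classical
  simpa [nextCut] using
    List.findIdx_le_length (p := fun c => decide (Attention H c)) (xs := List.range H.length)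

lemma attention_nextCut {H : List ℕ} (h : nextCut H < H.length) : Attention H (nextCut H) := by
  classical
  have h' : (List.range H.length).findIdx (fun c => decide (Attention H c)) <
      (List.range H.length).length := by simpa [nextCut] using h
  simpa [nextCut] using List.findIdx_getElem (w := h')

lemma nextCut_le_of_attention {H : List ℕ} {c : ℕ} (h : Attention H c) :
    nextCut H ≤ c := by
  classical
  by_contra hlt
  have := List.not_of_lt_findIdx (p := fun c => decide (Attention H c))
    (xs := List.range H.length) (i := c) (by simpa [nextCut] using hlt)
  simp [h] at this

lemma stamp_le_length (H : List ℕ) (j : ℕ) : stamp H j ≤ H.length := by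
  induction H with
  | nil => simp [stamp]
  | cons c H ih => simp only [stamp, List.length_cons]; split_ifs <;> omega

lemma stamp_mono (H : List ℕ) : Monotone (stamp H) := by
  intro i j hij
  induction H with
  | nil => simp [stamp]
  | cons c H ih =>
    have := stamp_le_length H i
    simp only [stamp]; split_ifs <;> omega

lemma marker_strictMono (H : List ℕ) : StrictMono (marker H) := fun i j hij => by
  have := Nat.mul_le_mul (stamp_mono H hij.le) (stamp_mono H hij.le)
  simp only [marker]; omega

lemma le_marker (H : List ℕ) (j : ℕ) : j ≤ marker H j := Nat.le_add_right _ _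

lemma marker_le (H : List ℕ) (j : ℕ) : marker H j ≤ j + 2 * (H.length * H.length) := by
  have := Nat.mul_le_mul (stamp_le_length H j) (stamp_le_length H j)
  simp only [marker]; omega

lemma marker_cons_of_lt {H : List ℕ} {c j : ℕ} (h : j < c) : marker (c :: H) j = marker H j := by
  simp [marker, stamp, h.not_ge]

lemma marker_cons_of_le {H : List ℕ} {c j : ℕ} (h : c ≤ j) :
    marker (c :: H) j = j + 2 * ((H.length + 1) * (H.length + 1)) := by
  simp [marker, stamp, h]

lemma marker_le_marker_cons (H : List ℕ) (c j : ℕ) : marker H j ≤ marker (c :: H) j := by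
  rcases lt_or_ge j c with h | h
  · rw [marker_cons_of_lt h]
  · rw [marker_cons_of_le h]
    exact (marker_le H j).trans (by gcongr <;> omega)

lemma marker_hist_of_le {s j : ℕ} (h : s ≤ j) : marker (hist s) j = j + 2 * (s * s) := by
  cases s with
  | zero => rfl
  | succ s =>
    have := nextCut_le_length (hist s)
    rw [length_hist] at this
    rw [hist, marker_cons_of_le (by omega), length_hist]

/-- The markers that remain after a cut have been markers before, of the same colour. -/
lemma exists_marker_hist_eq (s j : ℕ) :
    ∃ j', j' % 2 = j % 2 ∧ marker (hist s) j' = marker (hist (s + 1)) j := by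
  rw [hist]
  rcases lt_or_ge j (nextCut (hist s)) with h | h
  · exact ⟨j, rfl, (marker_cons_of_lt h).symm⟩
  -- The shift is `2(s+1)² - 2s²`; its evenness preserves the colour.
  · refine ⟨j + 2 * (2 * s + 1), by omega, ?_⟩
    rw [marker_cons_of_le h, length_hist, marker_hist_of_le (by omega)]
    ring

/-- Since `j ≤ marker H j`, the bound `x + 1` catches every marker at `x`. -/
lemma inCut_self_succ_iff {i : ℕ} {H : List ℕ} {x : ℕ} :
    InCut i H (x + 1) x ↔ ∀ j, ¬ (j % 2 = i ∧ marker H j = x) := by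
  refine ⟨fun h j hj => h j ?_ hj, fun h j _ => h j⟩
  have := le_marker H j
  omega

lemma inCut_hist_mono {i x s t : ℕ} (hst : s ≤ t) (h : InCut i (hist s) (x + 1) x) :
    InCut i (hist t) (x + 1) x := by
  induction t, hst using Nat.le_induction with
  | base => exact h
  | succ t _ ih =>
    rw [inCut_self_succ_iff] at ih ⊢
    rintro j ⟨hj, rfl⟩
    obtain ⟨j', h₁, h₂⟩ := exists_marker_hist_eq t j
    exact ih j' ⟨h₁.trans hj, h₂⟩

/-- A marker that is moved is enumerated. -/
lemma marker_mem_limitSet_of_cut {i s j : ℕ} (hj : nextCut (hist s) ≤ j) (hs : j ≤ s) :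
    marker (hist s) j ∈ limitSet i := by
  refine ⟨s + 1, inCut_self_succ_iff.2 ?_⟩
  rintro j' ⟨-, h⟩
  rw [hist] at h
  rcases lt_or_ge j' (nextCut (hist s)) with h' | h'
  · rw [marker_cons_of_lt h'] at h
    have := (marker_strictMono (hist s)).injective h
    omega
  · rw [marker_cons_of_le h', length_hist] at h
    have := marker_le (hist s) j
    rw [length_hist] at this
    -- The quadratic gap puts the new positions beyond `j + 2s²` for every `j ≤ s`.
    have h2 : (s + 1) * (s + 1) = s * s + 2 * s + 1 := by ring
    omega

lemma marker_hist_eq {s t j : ℕ} (h : ∀ t ≥ s, j < nextCut (hist t)) (hst : s ≤ t) :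
    marker (hist t) j = marker (hist s) j := by
  induction t, hst using Nat.le_induction with
  | base => rfl
  | succ t ht ih => rw [hist, marker_cons_of_lt (h t ht), ih]

/-- A marker that is never moved again stays in the complement. -/
lemma marker_notMem_limitSet {s j : ℕ} (h : ∀ t ≥ s, j < nextCut (hist t)) :
    marker (hist s) j ∉ limitSet (j % 2) := by
  rintro ⟨t, ht⟩
  have ht' := inCut_hist_mono (le_max_left t s) ht
  rw [inCut_self_succ_iff] at ht'
  exact ht' j ⟨rfl, marker_hist_eq h (le_max_right t s)⟩

/-- Markers below `c` are final, and the others lie beyond `x`. -/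
lemma mem_limitSet_iff_inCut {i s c x : ℕ} (h : ∀ t ≥ s, c ≤ nextCut (hist t))
    (hx : x < marker (hist s) c) : x ∈ limitSet i ↔ InCut i (hist s) c x := by
  constructor
  · rintro hx j hj ⟨rfl, rfl⟩
    exact marker_notMem_limitSet (fun t ht => hj.trans_le (h t ht)) hx
  · refine fun hc => ⟨s, inCut_self_succ_iff.2 ?_⟩
    rintro j ⟨hj, rfl⟩
    exact hc j ((marker_strictMono _).lt_iff_lt.1 hx) ⟨hj, rfl⟩

lemma initSeg_limitSet {i s c n : ℕ} (h : ∀ t ≥ s, c ≤ nextCut (hist t))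
    (hn : n ≤ marker (hist s) c) : initSeg (limitSet i) n = cutSeg i (hist s) c n := by
  refine List.map_congr_left fun x hx => ?_
  rw [decide_eq_decide]
  exact mem_limitSet_iff_inCut h ((List.mem_range.1 hx).trans_le hn)

end Markers

/-! ### Finite injury. -/

section FiniteInjury

open Filter

lemma tables_mono {e s t m : ℕ} {T : Table × Table} (hst : s ≤ t) (h : T ∈ tables e s m) :
    T ∈ tables e t m := by
  simp only [tables, Option.mem_def, Option.bind_eq_some_iff] at h ⊢
  obtain ⟨a, ha, hT⟩ := h
  exact ⟨a, evaln_mono hst ha, hT⟩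

lemma haltsBy_mono {k s t : ℕ} (hst : s ≤ t) (h : HaltsBy s k) : HaltsBy t k := by
  simp only [HaltsBy, Option.isSome_iff_exists] at h ⊢
  obtain ⟨a, ha⟩ := h
  exact ⟨a, evaln_mono hst ha⟩

lemma cutSeg_congr {i c n : ℕ} {H H' : List ℕ} (h : ∀ j < c, j % 2 = i → marker H j = marker H' j) :
    cutSeg i H c n = cutSeg i H' c n := by
  refine List.map_congr_left fun x _ => ?_
  rw [decide_eq_decide]
  refine forall₂_congr fun j hj => not_congr (and_congr_right fun hi => ?_)
  rw [h j hj hi]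

/-- A disagreement depends only on markers below `c`, which a cut at `c' ≥ c` leaves in place. -/
lemma Disagree.cons {H : List ℕ} {c c' b b' e : ℕ} (h : Disagree H c b e) (hc : c ≤ c')
    (hb : b ≤ b') : Disagree (c' :: H) c b' e := by
  obtain ⟨m, hm, T, hT, h₁, h₂, h₃⟩ := h
  have hs (i n : ℕ) : cutSeg i (c' :: H) c n = cutSeg i H c n :=
    cutSeg_congr fun j hj _ => marker_cons_of_lt (hj.trans_le hc)
  refine ⟨m, hm.trans (by simp), T, tables_mono (by simp) hT, h₁.trans hb, h₂.trans hb, ?_⟩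
  rwa [hs, hs]

lemma eventually_iff_succ {P : ℕ → Prop} (h : ∀ᶠ s in atTop, P s → P (s + 1)) :
    ∀ᶠ s in atTop, (P s ↔ P (s + 1)) := by
  obtain ⟨S, hS⟩ := eventually_atTop.1 h
  by_cases hP : ∃ s ≥ S, P s
  · obtain ⟨s, hs, hPs⟩ := hP
    have (t : ℕ) (ht : s ≤ t) : P t := by
      induction t, ht using Nat.le_induction with
      | base => exact hPs
      | succ t ht ih => exact hS t (by omega) ih
    exact eventually_atTop.2 ⟨s, fun t ht => iff_of_true (this t ht) (this _ (by omega))⟩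
  · push Not at hP
    exact eventually_atTop.2
      ⟨S, fun t ht => iff_of_false (hP t ht) (hP _ (by omega))⟩

/-- Every marker is moved only finitely often. -/
theorem eventually_le_nextCut (c : ℕ) : ∀ᶠ s in atTop, c ≤ nextCut (hist s) := by
  induction c with
  | zero => simp
  | succ c ih =>
    have hD : ∀ᶠ s in atTop, ∀ e ∈ Finset.range (c + 1),
        (Disagree (hist s) c (marker (hist s) c) e ↔
          Disagree (hist (s + 1)) c (marker (hist (s + 1)) c) e) := by
      refine (Finset.eventually_all _).2 fun e _ => eventually_iff_succ ?_
      filter_upwards [ih] with s hs h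
      exact h.cons hs (marker_le_marker_cons _ _ _)
    have hK : ∀ᶠ s in atTop, (HaltsBy s (c / 2) ↔ HaltsBy (s + 1) (c / 2)) :=
      eventually_iff_succ (Eventually.of_forall fun s => haltsBy_mono s.le_succ)
    filter_upwards [ih, hD, hK, eventually_gt_atTop c] with s hs hD hK hcs
    refine Nat.succ_le_of_lt (lt_of_le_of_ne hs fun hc => ?_)
    have hA := attention_nextCut (H := hist s) (by rw [length_hist]; omega)
    rw [← hc] at hA
    rcases hA with ⟨-, h₁, h₂⟩ | ⟨e, he, h₁, h₂⟩
    · rw [length_hist] at h₁ h₂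
      exact h₁ (hK.2 h₂)
    -- The cut sends marker `c` beyond the uses, so the disagreement becomes permanent; each `e ≤ c`
    -- can demand this only once.
    · refine h₂ ((hD e (Finset.mem_range.2 he)).2 (h₁.cons hs ?_))
      rw [hist, marker_cons_of_le hc.ge]
      nlinarith

lemma exists_forall_le_nextCut (c : ℕ) : ∃ S, ∀ s ≥ S, c ≤ nextCut (hist s) :=
  eventually_atTop.1 (eventually_le_nextCut c)

end FiniteInjury

/-! ### Sets below both limit sets are computable. -/

section MinimalPair

variable {T : ℕ → Table × Table}

lemma tables_of_eval {e m : ℕ} (he : ∀ m, encode (T m) ∈ eval (ofNat Code e) m) :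
    ∃ s, T m ∈ tables e s m := by
  obtain ⟨s, hs⟩ := evaln_complete.1 (he m)
  exact ⟨s, by rw [tables, Option.mem_def.1 hs, Option.bind_some, encodek]; rfl⟩

lemma eq_of_mem_tables {e s m : ℕ} {U : Table × Table}
    (he : ∀ m, encode (T m) ∈ eval (ofNat Code e) m) (h : U ∈ tables e s m) : U = T m := by
  simp only [tables, Option.mem_def, Option.bind_eq_some_iff] at h
  obtain ⟨a, ha, hU⟩ := h
  rw [← Part.mem_unique (he m) (evaln_sound ha), encodek] at hU
  exact (Option.some.inj hU).symm

/-- If the `e`-th pair of reductions agrees on the limit sets, then it also agrees on all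
approximations from the `e`-th one on. -/
lemma cutSeg_mem_iff {e c s m : ℕ} (he : ∀ m, encode (T m) ∈ eval (ofNat Code e) m)
    (hT : ∀ m, initSeg (limitSet 0) (T m).1.1 ∈ (T m).1.2 ↔
      initSeg (limitSet 1) (T m).2.1 ∈ (T m).2.2)
    (hec : e ≤ c) (hs : ∀ t ≥ s, c ≤ nextCut (hist t)) :
    cutSeg 0 (hist s) c (T m).1.1 ∈ (T m).1.2 ↔ cutSeg 1 (hist s) c (T m).2.1 ∈ (T m).2.2 := by
  by_contra hne
  obtain ⟨r, hr⟩ := tables_of_eval (m := m) he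
  obtain ⟨S, hS⟩ := exists_forall_le_nextCut (c + 1)
  obtain ⟨t, hst, hSt, hrt, hmt, h₁, h₂⟩ : ∃ t, s ≤ t ∧ S ≤ t ∧ r ≤ t ∧ m < t ∧
      (T m).1.1 ≤ t ∧ (T m).2.1 ≤ t :=
    ⟨s + S + r + m + (T m).1.1 + (T m).2.1 + 1, by omega⟩
  have hseg (i n : ℕ) : cutSeg i (hist t) c n = cutSeg i (hist s) c n :=
    cutSeg_congr fun j hj _ => marker_hist_eq (fun t ht => hj.trans_le (hs t ht)) hst
  have hst' : ∀ u ≥ t, c ≤ nextCut (hist u) := fun u hu => hs u (hst.trans hu)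
  have hA : Attention (hist t) c := by
    refine Or.inr ⟨e, by omega, ⟨m, by simpa using hmt, T m, ?_, ?_, ?_, ?_⟩, ?_⟩
    · simpa using tables_mono hrt hr
    · simpa using h₁
    · simpa using h₂
    · rwa [hseg, hseg]
    -- With uses below marker `c`, the approximations are true initial segments, where the pair
    -- agrees.
    · rintro ⟨m', -, U, hU, hU₁, hU₂, hne'⟩
      obtain rfl := eq_of_mem_tables he hU
      rw [← initSeg_limitSet hst' hU₁, ← initSeg_limitSet hst' hU₂] at hne'
      exact hne' (hT m')
  have := nextCut_le_of_attention hA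
  have := hS t hSt
  omega

lemma cutSeg_succ {i c n : ℕ} {H : List ℕ} (hi : c % 2 ≠ i) :
    cutSeg i H (c + 1) n = cutSeg i H c n := by
  refine List.map_congr_left fun x _ => ?_
  rw [decide_eq_decide]
  refine ⟨fun h j hj => h j (by omega), fun h j hj hx => ?_⟩
  rcases Nat.lt_succ_iff_lt_or_eq.1 hj with hj | rfl
  · exact h j hj hx
  · exact hi hx.1

/-- A pair of reductions that agrees on the limit sets computes the same set from the `e`-th
approximation. -/
lemma initSeg_mem_iff_cutSeg_mem {e s m : ℕ} (he : ∀ m, encode (T m) ∈ eval (ofNat Code e) m)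
    (hT : ∀ m, initSeg (limitSet 0) (T m).1.1 ∈ (T m).1.2 ↔
      initSeg (limitSet 1) (T m).2.1 ∈ (T m).2.2)
    (hs : ∀ t ≥ s, e ≤ nextCut (hist t)) :
    initSeg (limitSet 0) (T m).1.1 ∈ (T m).1.2 ↔ cutSeg 0 (hist s) e (T m).1.1 ∈ (T m).1.2 := by
  have key (c : ℕ) (hc : e ≤ c) : ∀ t, (∀ u ≥ t, c ≤ nextCut (hist u)) →
      (cutSeg 0 (hist t) c (T m).1.1 ∈ (T m).1.2 ↔
        cutSeg 0 (hist s) e (T m).1.1 ∈ (T m).1.2) := by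
    induction c, hc using Nat.le_induction with
    | base =>
      intro t ht
      rw [cutSeg_congr (H := hist t) (H' := hist s)]
      intro j hj _
      rw [← marker_hist_eq (fun u hu => hj.trans_le (ht u hu)) (le_max_left t s),
        ← marker_hist_eq (fun u hu => hj.trans_le (hs u hu)) (le_max_right t s)]
    | succ c hc ih =>
      intro t ht
      have ht' : ∀ u ≥ t, c ≤ nextCut (hist u) := fun u hu => by have := ht u hu; omega
      rw [← ih t ht']
      rcases Nat.mod_two_eq_zero_or_one c with h | h
      -- Marker `c` affects only the first set, so the comparison is made on the second.
      · rw [cutSeg_mem_iff he hT (by omega) ht, cutSeg_mem_iff he hT hc ht',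
          cutSeg_succ (by omega)]
      · rw [cutSeg_succ (by omega)]
  -- Past the use, the approximation is the true initial segment.
  obtain ⟨t, ht⟩ := exists_forall_le_nextCut (max e (T m).1.1)
  rw [← key _ (le_max_left _ _) t ht,
    initSeg_limitSet ht ((le_max_right _ _).trans (le_marker _ _))]

theorem isComputable_of_ttle {B : Set ℕ} (h₀ : TTLE B (limitSet 0)) (h₁ : TTLE B (limitSet 1)) :
    IsComputable B := by
  obtain ⟨f, g, hf, hg, hB⟩ := h₀
  obtain ⟨f', g', hf', hg', hB'⟩ := h₁
  let T : ℕ → Table × Table := fun m => ((f m, g m), (f' m, g' m))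
  have hTc : Computable T := (hf.pair hg).pair (hf'.pair hg')
  obtain ⟨code, hcode⟩ := exists_code.1 (Partrec.nat_iff.1 (Computable.encode.comp hTc).partrec)
  have he (m : ℕ) : encode (T m) ∈ eval (ofNat Code (encode code)) m := by
    simp [hcode]
  obtain ⟨s, hs⟩ := exists_forall_le_nextCut (encode code)
  have hseg : Computable fun m => cutSeg 0 (hist s) (encode code) (f m) :=
    (primrec_cutSeg 0).to_comp.comp ((Computable.const (hist s, encode code)).pair hf)
  have hmem := primrecPred_mem_list (Primrec.fst (α := List Bool) (β := List (List Bool)))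
    Primrec.snd
  have hdec := hmem.decide.to_comp.comp (hseg.pair hg)
  refine ComputablePred.of_eq (Computable.computablePred (p := fun m =>
    cutSeg 0 (hist s) (encode code) (f m) ∈ g m) hdec) fun m => ?_
  rw [hB m]
  exact (initSeg_mem_iff_cutSeg_mem he (fun m => (hB m).symm.trans (hB' m)) hs).symm

end MinimalPair

/-! ### Turing completeness and noncomputability. -/

section TuringCompleteness

/-- Whenever `s` is such that `q n s ∉ A`, the value `d n s` decides whether `n ∈ C`; then `A`
computes `C` by searching for such an `s`. -/
lemma turingLE_of_search {A C : Set ℕ} {q d : ℕ → ℕ → ℕ} (hq : Computable₂ q)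
    (hd : Computable₂ d) (hex : ∀ n, ∃ s, q n s ∉ A)
    (h : ∀ n s, q n s ∉ A → d n s ∈ charFun C n) : TuringLE C A := by
  classical
  have hq' : Nat.Partrec fun p : ℕ => (q p.unpair.1 p.unpair.2 : Part ℕ) :=
    Partrec.nat_iff.1 (hq.comp (Computable.fst.comp Computable.unpair)
      (Computable.snd.comp Computable.unpair)).partrec
  have hd' : Nat.Partrec fun p : ℕ => (d p.unpair.1 p.unpair.2 : Part ℕ) :=
    Partrec.nat_iff.1 (hd.comp (Computable.fst.comp Computable.unpair)
      (Computable.snd.comp Computable.unpair)).partrec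
  have hA : Nat.RecursiveIn {charFun A} (charFun A) := .oracle _ rfl
  have hqA : Nat.RecursiveIn {charFun A} fun p : ℕ => charFun A (q p.unpair.1 p.unpair.2) :=
    (Nat.RecursiveIn.comp hA hq'.recursiveIn).of_eq fun p => Part.bind_some _ _
  have hsearch : Nat.RecursiveIn {charFun A} fun n : ℕ =>
      Nat.rfind fun s => Part.some (decide (q n s ∉ A)) := by
    refine hqA.rfind.of_eq fun n => congrArg Nat.rfind (funext fun s => ?_)
    by_cases hs : q n s ∈ A <;> simp [charFun, hs]
  have hdom (n : ℕ) : ∃ s, s ∈ Nat.rfind fun s => Part.some (decide (q n s ∉ A)) := by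
    obtain ⟨s, hs⟩ := hex n
    obtain ⟨t, ht, -⟩ := Nat.rfind_min' (p := fun s => decide (q n s ∉ A)) (decide_eq_true hs)
    exact ⟨t, ht⟩
  choose t ht using hdom
  have htA (n : ℕ) : q n (t n) ∉ A := by simpa using Nat.rfind_spec (ht n)
  have hpair : Nat.RecursiveIn {charFun A} fun n : ℕ => Part.some (Nat.pair n (t n)) :=
    (Nat.RecursiveIn.pair Nat.Partrec.some.recursiveIn
      (hsearch.of_eq fun n => Part.eq_some_iff.2 (ht n))).of_eq fun n => by simp [Seq.seq]
  refine RecursiveIn.iff_nat.2 ((Nat.RecursiveIn.comp hd'.recursiveIn hpair).of_eq fun n => ?_)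
  refine (Part.bind_some _ _).trans ?_
  rw [Part.eq_some_iff.2 (h n (t n) (htA n)), Nat.unpair_pair]
  rfl

lemma isCE_limitSet (i : ℕ) : IsCE (limitSet i) := by
  have hc : PrimrecPred fun p : ℕ × ℕ => InCut i (hist p.2) (p.1 + 1) p.1 :=
    (primrecPred_inCut i).comp (Primrec.pair (Primrec.pair (primrec_hist.comp Primrec.snd)
      (Primrec.succ.comp Primrec.fst)) Primrec.fst)
  have hr : Partrec fun x => Nat.rfind fun s =>
      Part.some (decide (InCut i (hist s) (x + 1) x)) := Partrec.rfind hc.decide.to_comp.partrec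
  refine hr.dom_re.of_eq fun x => ?_
  refine Nat.rfind_dom.trans ?_
  simp [limitSet]

/-- A marker outside the limit set has reached its final position, and its index has been decided
by then. -/
lemma haltsBy_of_marker_notMem {i k s t : ℕ} (hi : i < 2) (hs : 2 * k + i < s)
    (h : marker (hist s) (2 * k + i) ∉ limitSet i) (hst : s ≤ t) (ht : HaltsBy t k) :
    HaltsBy s k := by
  have hstep (u : ℕ) (hu : s ≤ u) :
      marker (hist u) (2 * k + i) = marker (hist s) (2 * k + i) := by
    induction u, hu using Nat.le_induction with
    | base => rfl
    | succ u hu ih =>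
      rw [hist, marker_cons_of_lt, ih]
      by_contra hlt
      exact h (ih ▸ marker_mem_limitSet_of_cut (not_lt.1 hlt) (by omega))
  induction t, hst using Nat.le_induction with
  | base => exact ht
  | succ t hst ih =>
    refine ih ?_
    by_contra hn
    have hA : Attention (hist t) (2 * k) :=
      Or.inl ⟨by omega, by simpa using hn, by simpa using ht⟩
    have := nextCut_le_of_attention hA
    -- A cut at or below `2k` also moves marker `2k + i`, enumerating its old position.
    exact h (hstep t hst ▸ marker_mem_limitSet_of_cut (by omega) (by omega))

lemma exists_haltsBy_iff {c : Code} {n : ℕ} :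
    (∃ s, HaltsBy s (Nat.pair (encode c) n)) ↔ (eval c n).Dom := by
  simp only [HaltsBy, Nat.unpair_pair, ofNat_encode, Option.isSome_iff_exists, Part.dom_iff_mem,
    evaln_complete]
  exact exists_comm

theorem isTuringCompleteCE_limitSet {i : ℕ} (hi : i < 2) : IsTuringCompleteCE (limitSet i) := by
  classical
  refine ⟨isCE_limitSet i, fun C hC => ?_⟩
  obtain ⟨c, hc⟩ := exists_code.1 (Partrec.nat_iff.1
    (Partrec.map hC (Computable.const 0).to₂))
  have hdom (n : ℕ) : (eval c n).Dom ↔ n ∈ C := by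
    rw [hc]; simp [Part.dom_iff_mem]
  let j : ℕ → ℕ := fun n => 2 * Nat.pair (encode c) n + i
  have hk : Primrec fun n => Nat.pair (encode c) n :=
    Primrec₂.natPair.comp (Primrec.const _) Primrec.id
  have hj : Primrec j :=
    Primrec.nat_add.comp (Primrec.nat_mul.comp (Primrec.const 2) hk) (Primrec.const i)
  have hσ : Primrec fun p : ℕ × ℕ => p.2 + j p.1 + 1 :=
    Primrec.succ.comp (Primrec.nat_add.comp Primrec.snd (hj.comp Primrec.fst))
  have hd : Primrec fun p : ℕ × ℕ =>
      if HaltsBy (p.2 + j p.1 + 1) (Nat.pair (encode c) p.1) then 1 else 0 :=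
    Primrec.ite (primrecRel_haltsBy.comp hσ (hk.comp Primrec.fst)) (Primrec.const 1)
      (Primrec.const 0)
  refine turingLE_of_search (q := fun n s => marker (hist (s + j n + 1)) (j n))
    (d := fun n s => if HaltsBy (s + j n + 1) (Nat.pair (encode c) n) then 1 else 0)
    (primrec_marker.comp (primrec_hist.comp hσ) (hj.comp Primrec.fst)).to_comp hd.to_comp
    (fun n => ?_) (fun n s hs => ?_)
  · obtain ⟨S, hS⟩ := exists_forall_le_nextCut (j n + 1)
    have := marker_notMem_limitSet (s := S + j n + 1) (j := j n) fun t ht => hS t (by omega)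
    rw [show j n % 2 = i by simp only [j]; omega] at this
    exact ⟨S, this⟩
  · have : HaltsBy (s + j n + 1) (Nat.pair (encode c) n) ↔ n ∈ C := by
      rw [← hdom, ← exists_haltsBy_iff]
      refine ⟨fun h => ⟨_, h⟩, fun ⟨t, ht⟩ => ?_⟩
      exact haltsBy_of_marker_notMem hi (by simp only [j]; omega) hs
        (le_max_right t (s + j n + 1)) (haltsBy_mono (le_max_left _ _) ht)
    simp only [charFun, this, Part.mem_some_iff]

/-- A computable oracle would make the halting set computable. -/
lemma IsTuringCompleteCE.not_isComputable {A : Set ℕ} (hA : IsTuringCompleteCE A) :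
    ¬ IsComputable A := by
  classical
  intro hcomp
  let C : Set ℕ := {n | (eval (ofNat Code n) 0).Dom}
  have hC : IsCE C :=
    (eval_part.comp (Computable.ofNat Code) (Computable.const 0)).dom_re
  have hAp : Partrec (charFun A) :=
    (ComputablePred.ite (Computable.const 1) (Computable.const 0) hcomp).partrec
  have hCp : Partrec (charFun C) :=
    RecursiveIn.partrec_of_oracle (by simpa using hAp) (hA.2 C hC)
  have hCc : Computable fun n => if n ∈ C then 1 else 0 := hCp
  have hdec : ComputablePred fun n => n ∈ C :=
    Computable.computablePred (((Primrec.beq (α := ℕ)).to_comp.comp hCc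
      (Computable.const 1)).of_eq fun n => by by_cases h : n ∈ C <;> simp [h])
  refine ComputablePred.halting_problem 0 (ComputablePred.of_eq (Computable.computablePred
    (p := fun c : Code => encode c ∈ C) (hdec.decide.comp Computable.encode)) fun c => ?_)
  simp [C]

end TuringCompleteness

end TTMinimalPair

theorem mainTheorem4 :
    ∃ A₁ A₂ : Set ℕ,
      TTMinimalPair.IsTuringCompleteCE A₁ ∧ TTMinimalPair.IsTuringCompleteCE A₂ ∧
        TTMinimalPair.IsTTMinimalPair A₁ A₂ := by
  have h₀ := TTMinimalPair.isTuringCompleteCE_limitSet (i := 0) (by norm_num)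
  have h₁ := TTMinimalPair.isTuringCompleteCE_limitSet (i := 1) (by norm_num)
  exact ⟨_, _, h₀, h₁, h₀.not_isComputable, h₁.not_isComputable,
    fun B => TTMinimalPair.isComputable_of_ttle⟩
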